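/- **Definitions.** An *order unit space* is a real ordered vector space $E$ with an element $e\ge 0$ such that every $x\in E$ satisfies $x\le re$ for some $r\in\mathbb{R}$ (order unit), and such that $x\le re$ for all $r>0$ implies $x\le 0$ (Archimedean property). Its norm is $\|x\|=\inf\{r>0 \mid -re\le x\le re\}$, and its state space $S(E)$ is the convex set of positive linear maps $\sigma\colon E\to\mathbb{R}$ with $\sigma(e)=1$, with the $w^*$-topology (pointwise convergence on $E$). A *Lip-norm* on $E$ is a seminorm $L\colon E\to[0,\infty]$ (with $0\cdot\infty=0$) such that $\{x\mid L(x)=0\}=\mathbb{R}e$ and such that the topology on $S(E)$ induced by the metric $$\rho_L(\sigma,\tau)=\sup\{|\sigma(x)-\tau(x)| \mid x\in E,\ L(x)\le 1\}$$ is the $w^*$-topology. A *quantum metric Choquet simplex* is a pair $(E,L)$ of an order unit space $E$ and a Lip-norm $L$ on $E$ such that $E$ is norm complete, $E$ has the Riesz interpolation property (if $x_i\le y_j$ for $i,j\in\{1,2\}$, there is $z\in E$ with $x_1,x_2\le z\le y_1,y_2$), $L$ is lower semicontinuous in norm, and $\{x\mid L(x)<\infty\}$ is norm dense in $E$. Let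 $\mathrm{dist}_{\mathrm H}^{\rho}$ denote the ($[0,\infty]$-valued) Hausdorff distance with respect to $\rho$. A Lip-norm $L$ on the direct sum $E_1\oplus E_2$ (componentwise order, order unit $(e_1,e_2)$) is *admissible* for Lip-norms $L_1$ on $E_1$ and $L_2$ on $E_2$ if $L_i(x)=\inf\{L(y)\mid y\in E_1\oplus E_2,\ \pi_i(y)=x\}$ for $i=1,2$ and all $x\in E_i$, where $\pi_i\colon E_1\oplus E_2\to E_i$ is the projection. The *quantum Gromov--Hausdorff distance* is $$\mathrm{dist}_q(E_1,E_2)=\inf\{\mathrm{dist}_{\mathrm H}^{\rho_L}(\{\sigma\circ\pi_1\mid\sigma\in S(E_1)\},\{\tau\circ\pi_2\mid\tau\in S(E_2)\}) \mid L \text{ an admissible Lip-norm on } E_1\oplus E_2\}.$$ **Proposition.** Let $(E_1,L_1)$ and $(E_2,L_2)$ be quantum metric Choquet simplices. Then $$\mathrm{dist}_q(E_1,E_2)=\inf\,\mathrm{dist}_{\mathrm H}^{\rho_L}\bigl(h_1(S(E_1)),h_2(S(E_2))\bigr),$$ where the infimum is taken over all quantum metric Choquet simplices $(E,L)$ and all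 pairs of maps $h_1\colon S(E_1)\to S(E)$, $h_2\colon S(E_2)\to S(E)$ that are affine and isometric from $\rho_{L_i}$ to $\rho_L$. -/

import Mathlib

open scoped ENNReal

universe u v

namespace QuantumMetric

/-- An order unit space: a real ordered vector space with an order unit, written `1`, that has the
Archimedean property. The norm is not extra data: `norm_eq` says that it is the order unit norm
`‖x‖ = inf {r > 0 | -r 1 ≤ x ≤ r 1}`. -/
class OrderUnitSpace (E : Type u) [NormedAddCommGroup E] [NormedSpace ℝ E] [PartialOrder E]
    [One E] : Prop extends IsOrderedAddMonoid E, PosSMulMono ℝ E where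
  unit_nonneg : (0 : E) ≤ 1
  exists_le_smul_unit : ∀ x : E, ∃ r : ℝ, x ≤ r • (1 : E)
  archimedean : ∀ x : E, (∀ r : ℝ, 0 < r → x ≤ r • (1 : E)) → x ≤ 0
  norm_eq : ∀ x : E, ‖x‖ = sInf {r : ℝ | 0 < r ∧ -(r • (1 : E)) ≤ x ∧ x ≤ r • (1 : E)}

section OneSpace

variable {E : Type u} [NormedAddCommGroup E] [NormedSpace ℝ E] [PartialOrder E] [One E]

theorem smul_unit_mono [OrderUnitSpace E] {r s : ℝ} (h : r ≤ s) :
    r • (1 : E) ≤ s • (1 : E) := by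
  have h1 : (0 : E) ≤ (s - r) • (1 : E) :=
    smul_nonneg (sub_nonneg.2 h) OrderUnitSpace.unit_nonneg
  rw [sub_smul] at h1
  exact sub_nonneg.1 h1

theorem exists_bound_unit [OrderUnitSpace E] (x : E) :
    ∃ r : ℝ, 0 < r ∧ -(r • (1 : E)) ≤ x ∧ x ≤ r • (1 : E) := by
  obtain ⟨a, ha⟩ := OrderUnitSpace.exists_le_smul_unit x
  obtain ⟨b, hb⟩ := OrderUnitSpace.exists_le_smul_unit (-x)
  refine ⟨max 1 (max a b), by positivity, ?_, ?_⟩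
  · exact neg_le.1 (hb.trans (smul_unit_mono ((le_max_right a b).trans (le_max_right _ _))))
  · exact ha.trans (smul_unit_mono ((le_max_left a b).trans (le_max_right _ _)))

variable (E) in
/-- The state space `S(E)`: the positive unital linear functionals `E → ℝ`. -/
def stateSpace : Set (E →ₗ[ℝ] ℝ) :=
  {σ | (∀ x, 0 ≤ x → 0 ≤ σ x) ∧ σ 1 = 1}

variable (E) in
/-- The `w*`-topology on the state space: the topology of pointwise convergence on `E`. -/
abbrev weakStarTopology : TopologicalSpace (stateSpace E) :=
  TopologicalSpace.induced (fun (σ : stateSpace E) (x : E) => σ.1 x) inferInstance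

/-- `ρ_L(σ, τ) = sup {|σ(x) - τ(x)| : L(x) ≤ 1}`, as an extended distance on the state space. -/
noncomputable def stateDist (L : E → ℝ≥0∞) (σ τ : stateSpace E) : ℝ≥0∞ :=
  ⨆ (x : E) (_ : L x ≤ 1), ENNReal.ofReal |σ.1 x - τ.1 x|

/-- The state space with the distance `ρ_L` and the topology that this distance induces. -/
noncomputable abbrev stateEMetric (L : E → ℝ≥0∞) : PseudoEMetricSpace (stateSpace E) where
  edist := stateDist L
  edist_self σ := by simp [stateDist]
  edist_comm σ τ := by simp only [stateDist, abs_sub_comm]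
  edist_triangle σ τ υ := by
    refine iSup₂_le fun x hx => ?_
    calc ENNReal.ofReal |σ.1 x - υ.1 x|
        ≤ ENNReal.ofReal (|σ.1 x - τ.1 x| + |τ.1 x - υ.1 x|) :=
          ENNReal.ofReal_le_ofReal (abs_sub_le _ _ _)
      _ = ENNReal.ofReal |σ.1 x - τ.1 x| + ENNReal.ofReal |τ.1 x - υ.1 x| :=
          ENNReal.ofReal_add (abs_nonneg _) (abs_nonneg _)
      _ ≤ stateDist L σ τ + stateDist L τ υ :=
          add_le_add (le_iSup₂_of_le x hx le_rfl) (le_iSup₂_of_le x hx le_rfl)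

/-- The Hausdorff distance between two sets of states, with respect to `ρ_L`. -/
noncomputable def stateHausdorffDist (L : E → ℝ≥0∞) (A B : Set (stateSpace E)) : ℝ≥0∞ :=
  letI := stateEMetric L
  Metric.hausdorffEDist A B

/-- A Lip-norm: a `[0, ∞]`-valued seminorm with kernel `ℝ 1` such that the distance `ρ_L` induces
the `w*`-topology on the state space. (The `w*`-topology is Hausdorff and makes the convex set
`S(E)` connected, so `ρ_L` is then automatically a finite-valued metric.) -/
structure IsLipNorm (L : E → ℝ≥0∞) : Prop where
  add_le : ∀ x y, L (x + y) ≤ L x + L y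
  smul_eq : ∀ (r : ℝ) (x : E), L (r • x) = ENNReal.ofReal |r| * L x
  eq_zero_iff : ∀ x, L x = 0 ↔ ∃ r : ℝ, x = r • (1 : E)
  topology_eq : (stateEMetric L).toUniformSpace.toTopologicalSpace = weakStarTopology E

/-- `(E, L)` is a quantum metric Choquet simplex. -/
structure IsQMCS [OrderUnitSpace E] (L : E → ℝ≥0∞) : Prop where
  isLipNorm : IsLipNorm L
  complete : CompleteSpace E
  riesz : ∀ x₁ x₂ y₁ y₂ : E, x₁ ≤ y₁ → x₁ ≤ y₂ → x₂ ≤ y₁ → x₂ ≤ y₂ →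
    ∃ z, x₁ ≤ z ∧ x₂ ≤ z ∧ z ≤ y₁ ∧ z ≤ y₂
  lowerSemicontinuous : LowerSemicontinuous L
  denselyFinite : Dense {x | L x < ⊤}

end OneSpace

section TwoSpaces

variable {E : Type u} [NormedAddCommGroup E] [NormedSpace ℝ E] [PartialOrder E] [One E]
variable {F : Type v} [NormedAddCommGroup F] [NormedSpace ℝ F] [PartialOrder F] [One F]

/-- The direct sum of two order unit spaces: componentwise order and order unit `(1, 1)`. -/
instance [OrderUnitSpace E] [OrderUnitSpace F] : OrderUnitSpace (E × F) where
  smul_le_smul_of_nonneg_left r hr x y h :=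
    ⟨smul_le_smul_of_nonneg_left h.1 hr, smul_le_smul_of_nonneg_left h.2 hr⟩
  unit_nonneg := ⟨OrderUnitSpace.unit_nonneg, OrderUnitSpace.unit_nonneg⟩
  exists_le_smul_unit x := by
    obtain ⟨a, ha⟩ := OrderUnitSpace.exists_le_smul_unit x.1
    obtain ⟨b, hb⟩ := OrderUnitSpace.exists_le_smul_unit x.2
    exact ⟨max a b, ha.trans (smul_unit_mono (le_max_left _ _)),
      hb.trans (smul_unit_mono (le_max_right _ _))⟩
  archimedean x h :=
    ⟨OrderUnitSpace.archimedean x.1 fun r hr => (h r hr).1,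
      OrderUnitSpace.archimedean x.2 fun r hr => (h r hr).2⟩
  norm_eq x := by
    have hbdd : ∀ s : Set ℝ, (∀ r ∈ s, 0 < r) → BddBelow s :=
      fun s hs => ⟨0, fun r hr => (hs r hr).le⟩
    rw [Prod.norm_def, OrderUnitSpace.norm_eq x.1, OrderUnitSpace.norm_eq x.2]
    apply le_antisymm
    · refine le_csInf ?_ ?_
      · obtain ⟨a, ha, ha1, ha2⟩ := exists_bound_unit x.1
        obtain ⟨b, hb, hb1, hb2⟩ := exists_bound_unit x.2
        refine ⟨max a b, lt_max_of_lt_left ha, ⟨?_, ?_⟩, ⟨?_, ?_⟩⟩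
        · exact (neg_le_neg (smul_unit_mono (le_max_left a b))).trans ha1
        · exact (neg_le_neg (smul_unit_mono (le_max_right a b))).trans hb1
        · exact ha2.trans (smul_unit_mono (le_max_left a b))
        · exact hb2.trans (smul_unit_mono (le_max_right a b))
      · rintro r ⟨hr, h1, h2⟩
        exact max_le (csInf_le (hbdd _ fun r hr => hr.1) ⟨hr, h1.1, h2.1⟩)
          (csInf_le (hbdd _ fun r hr => hr.1) ⟨hr, h1.2, h2.2⟩)
    · refine le_of_forall_gt_imp_ge_of_dense fun c hc => ?_
      obtain ⟨a, ⟨ha, ha1, ha2⟩, hac⟩ := exists_lt_of_csInf_lt (exists_bound_unit x.1)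
        ((le_max_left _ _).trans_lt hc)
      obtain ⟨b, ⟨hb, hb1, hb2⟩, hbc⟩ := exists_lt_of_csInf_lt (exists_bound_unit x.2)
        ((le_max_right _ _).trans_lt hc)
      refine csInf_le (hbdd _ fun r hr => hr.1) ⟨ha.trans hac, ⟨?_, ?_⟩, ⟨?_, ?_⟩⟩
      · exact (neg_le_neg (smul_unit_mono hac.le)).trans ha1
      · exact (neg_le_neg (smul_unit_mono hbc.le)).trans hb1
      · exact ha2.trans (smul_unit_mono hac.le)
      · exact hb2.trans (smul_unit_mono hbc.le)

/-- The map `S(E) → S(E ⊕ F)`, `σ ↦ σ ∘ π₁`, dual to the first projection. -/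
noncomputable def stateFst (σ : stateSpace E) : stateSpace (E × F) :=
  ⟨σ.1 ∘ₗ LinearMap.fst ℝ E F, fun x hx => σ.2.1 x.1 hx.1, σ.2.2⟩

/-- The map `S(F) → S(E ⊕ F)`, `τ ↦ τ ∘ π₂`, dual to the second projection. -/
noncomputable def stateSnd (τ : stateSpace F) : stateSpace (E × F) :=
  ⟨τ.1 ∘ₗ LinearMap.snd ℝ E F, fun x hx => τ.2.1 x.2 hx.2, τ.2.2⟩

/-- A Lip-norm `L` on `E ⊕ F` is admissible if `L_E` and `L_F` are the quotient seminorms of `L`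
under the two projections. -/
structure IsAdmissible (L_E : E → ℝ≥0∞) (L_F : F → ℝ≥0∞) (L : E × F → ℝ≥0∞) : Prop where
  isLipNorm : IsLipNorm L
  fst_eq : ∀ x : E, L_E x = sInf {c | ∃ z : E × F, z.1 = x ∧ L z = c}
  snd_eq : ∀ y : F, L_F y = sInf {c | ∃ z : E × F, z.2 = y ∧ L z = c}

/-- The quantum Gromov--Hausdorff distance between `(E, L_E)` and `(F, L_F)`. -/
noncomputable def quantumDist (L_E : E → ℝ≥0∞) (L_F : F → ℝ≥0∞) : ℝ≥0∞ :=
  sInf {d | ∃ L : E × F → ℝ≥0∞, IsAdmissible L_E L_F L ∧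
    d = stateHausdorffDist L (Set.range stateFst) (Set.range stateSnd)}

/-- `h : S(E) → S(F)` is affine: it preserves convex combinations of states. -/
def IsAffineMap (h : stateSpace E → stateSpace F) : Prop :=
  ∀ (σ τ υ : stateSpace E) (a b : ℝ), 0 ≤ a → 0 ≤ b → a + b = 1 →
    υ.1 = a • σ.1 + b • τ.1 → (h υ).1 = a • (h σ).1 + b • (h τ).1

/-- `h : S(E) → S(F)` is an affine isometric embedding from `ρ_{L_E}` to `ρ_{L_F}`. -/
structure IsAffineIsometricEmbedding (L_E : E → ℝ≥0∞) (L_F : F → ℝ≥0∞)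
    (h : stateSpace E → stateSpace F) : Prop where
  affine : IsAffineMap h
  isometric : ∀ σ τ, stateDist L_F (h σ) (h τ) = stateDist L_E σ τ

end TwoSpaces

end QuantumMetric

/-!
Write `S(E)` for the state space of `E` and `ρ_L` for the distance of a Lip-norm `L`.

*The infimum over ambient spaces is at most the quantum distance.* Given an admissible Lip-norm `L`
on `E₁ ⊕ E₂`, the ambient space is `E₁ ⊕ E₂` itself. `L` need not be lower semicontinuous, but the
Lipschitz constant with respect to `ρ_L` (`lipschitzSeminorm`) is a lower semicontinuous seminorm
with the same distance. It is finite on a dense set (`IsLipNorm.dense_lt_top`). Riesz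
interpolation and completeness hold componentwise, and the duals of the projections are isometric
because `L₁` and `L₂` are quotients of `L` (`stateDist_eq_of_quotient`).

*The quantum distance is at most the infimum.* Given isometric affine maps
`hᵢ : S(Eᵢ) → S(G)` and `ε > 0`, put `d(σ, τ) = ρ(h₁ σ, h₂ τ) + ε` and let `bridgeSeminorm` be the
seminorm on `E₁ ⊕ E₂` with unit ball
`{(x, y) | L₁ x ≤ 1, L₂ y ≤ 1, |σ(x) - τ(y)| ≤ d(σ, τ) for all σ, τ}`.
Its distance between `σ` and `τ` is at most `d(σ, τ)`, which bounds the Hausdorff distance. It is a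
Lip-norm: `S(E₁ ⊕ E₂)` with its distance is a continuous image of `[0, 1] × S(E₁) × S(E₂)`, hence
compact, and a compact topology finer than the Hausdorff `w*`-topology equals it
(`compactSpace_bridgeSeminorm`, `topology_eq_weakStar_of_compactSpace`). It is admissible by
`exists_unitBall_lift`: every `x` with `L₁ x ≤ 1` has a partner `y`.

The lift, and the density above, come from one minimax statement, `exists_uniform_approx`. An
affine function on `S(E₁)` that is `1`-Lipschitz for the distance pulled back along `h₁` is
approximated on each pair of states by elements of the unit ball of `G`; since the error is
affine in the pair of states and in the element, and the pairs form a compact convex set, Sion's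
minimax theorem makes the approximation uniform. Applied to `x` on `S(E₁)` this gives `z` in the
unit ball of `G`, and applied to `z ∘ h₂` on `S(E₂)` it gives `y`.
-/

open scoped Topology

universe w

namespace QuantumMetric

/-! ### States of order unit spaces -/

section OrderUnit

variable {E : Type u} [NormedAddCommGroup E] [NormedSpace ℝ E] [PartialOrder E] [One E]

@[simp]
theorem state_one (σ : stateSpace E) : σ.1 1 = 1 := σ.2.2

theorem state_smul_unit (σ : stateSpace E) (r : ℝ) : σ.1 (r • (1 : E)) = r := by simp

theorem continuous_weakStar_eval (x : E) :
    Continuous[weakStarTopology E, _] fun σ : stateSpace E => σ.1 x := by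
  let _ := weakStarTopology E
  exact (continuous_apply x).comp continuous_induced_dom

theorem t2Space_weakStar : @T2Space (stateSpace E) (weakStarTopology E) := by
  let _ := weakStarTopology E
  refine T2Space.of_injective_continuous
    (f := fun (σ : stateSpace E) (x : E) => σ.1 x) (fun σ τ h => ?_) continuous_induced_dom
  exact Subtype.ext (LinearMap.ext fun x => congrFun h x)

theorem exists_convexCombination (σ τ : stateSpace E) {a b : ℝ} (ha : 0 ≤ a) (hb : 0 ≤ b)
    (hab : a + b = 1) : ∃ υ : stateSpace E, υ.1 = a • σ.1 + b • τ.1 :=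
  ⟨⟨a • σ.1 + b • τ.1,
    fun x hx => by
      simpa using add_nonneg (mul_nonneg ha (σ.2.1 x hx)) (mul_nonneg hb (τ.2.1 x hx)),
    by simpa using hab⟩, rfl⟩

variable [OrderUnitSpace E]

theorem le_smul_unit_of_norm_lt {x : E} {r : ℝ} (h : ‖x‖ < r) : x ≤ r • (1 : E) := by
  rw [OrderUnitSpace.norm_eq] at h
  obtain ⟨s, ⟨-, -, hs⟩, hsr⟩ := exists_lt_of_csInf_lt (exists_bound_unit x) h
  exact hs.trans (smul_unit_mono hsr.le)

theorem norm_le_of_le_smul_unit {x : E} {r : ℝ} (hr : 0 < r) (h₁ : -(r • (1 : E)) ≤ x)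
    (h₂ : x ≤ r • (1 : E)) : ‖x‖ ≤ r := by
  rw [OrderUnitSpace.norm_eq]
  exact csInf_le ⟨0, fun s hs => hs.1.le⟩ ⟨hr, h₁, h₂⟩

theorem state_mono (σ : stateSpace E) {x y : E} (h : x ≤ y) : σ.1 x ≤ σ.1 y := by
  have := σ.2.1 (y - x) (sub_nonneg.2 h)
  rw [map_sub] at this
  linarith

theorem abs_state_le_norm (σ : stateSpace E) (x : E) : |σ.1 x| ≤ ‖x‖ := by
  refine le_of_forall_gt_imp_ge_of_dense fun r hr => abs_le.2 ⟨?_, ?_⟩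
  · have := state_mono σ (le_smul_unit_of_norm_lt (x := -x) (r := r) (by rwa [norm_neg]))
    rw [map_neg, state_smul_unit] at this
    linarith
  · simpa using state_mono σ (le_smul_unit_of_norm_lt hr)

theorem continuous_state (σ : stateSpace E) : Continuous fun x : E => σ.1 x :=
  (σ.1.mkContinuous 1 fun x => by simpa using abs_state_le_norm σ x).continuous

theorem isClosed_nonpos : IsClosed {x : E | x ≤ 0} := by
  refine isClosed_of_closure_subset fun x hx => OrderUnitSpace.archimedean x fun r hr => ?_
  obtain ⟨y, hy, hxy⟩ := Metric.mem_closure_iff.1 hx r hr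
  rw [dist_eq_norm] at hxy
  have h := add_le_add (le_smul_unit_of_norm_lt hxy) (show y ≤ 0 from hy)
  simpa using h

/-- The states determine the order. If `x ≤ 0` fails, a functional separating `x` from the closed
cone of negative elements is positive, and it can be normalized to a state. -/
theorem nonpos_of_forall_state {x : E} (h : ∀ σ : stateSpace E, σ.1 x ≤ 0) : x ≤ 0 := by
  by_contra hx
  have hconv : Convex ℝ {x : E | x ≤ 0} := by
    intro a ha b hb s t hs ht _
    exact add_nonpos (smul_nonpos_of_nonneg_of_nonpos hs ha)
      (smul_nonpos_of_nonneg_of_nonpos ht hb)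
  obtain ⟨f, c, hf, hc⟩ := geometric_hahn_banach_closed_point hconv isClosed_nonpos hx
  have hc0 : 0 < c := by simpa using hf 0 le_rfl
  have hpos : ∀ y, 0 ≤ y → 0 ≤ f y := by
    intro y hy
    by_contra! hlt
    -- a large negative multiple of `y` would violate the bound `f < c` on the cone
    have h1 := hf ((c / f y) • y) (by
      exact smul_nonpos_of_nonpos_of_nonneg (div_nonpos_of_nonneg_of_nonpos hc0.le hlt.le) hy)
    rw [map_smul, smul_eq_mul, div_mul_cancel₀ _ hlt.ne] at h1
    exact lt_irrefl _ h1
  obtain ⟨r, hr, -, hxr⟩ := exists_bound_unit x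
  have h1 : 0 < f 1 := by
    have h2 := hpos _ (sub_nonneg.2 hxr)
    rw [map_sub, map_smul, smul_eq_mul] at h2
    by_contra! h3
    nlinarith
  let σ : stateSpace E := ⟨(f 1)⁻¹ • f.toLinearMap,
    fun y hy => by simpa using mul_nonneg (inv_nonneg.2 h1.le) (hpos y hy), by simp [h1.ne']⟩
  have h2 : (f 1)⁻¹ * f x ≤ 0 := h σ
  have h3 : 0 < (f 1)⁻¹ * f x := mul_pos (inv_pos.2 h1) (hc0.trans hc)
  linarith

theorem le_smul_unit_of_forall_state {x : E} {r : ℝ} (h : ∀ σ : stateSpace E, σ.1 x ≤ r) :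
    x ≤ r • (1 : E) :=
  sub_nonpos.1 <| nonpos_of_forall_state fun σ => by simpa using h σ

theorem norm_le_of_forall_state {x : E} {r : ℝ} (hr : 0 < r)
    (h : ∀ σ : stateSpace E, |σ.1 x| ≤ r) : ‖x‖ ≤ r := by
  refine norm_le_of_le_smul_unit hr ?_ (le_smul_unit_of_forall_state fun σ => (abs_le.1 (h σ)).2)
  refine neg_le.1 (le_smul_unit_of_forall_state fun σ => ?_)
  rw [map_neg]
  linarith [(abs_le.1 (h σ)).1]

theorem eq_zero_of_forall_state {x : E} (h : ∀ σ : stateSpace E, σ.1 x = 0) : x = 0 :=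
  le_antisymm (nonpos_of_forall_state fun σ => (h σ).le)
    (neg_nonpos.1 <| nonpos_of_forall_state fun σ => by simp [h σ])

theorem subsingleton_of_isEmpty_stateSpace [IsEmpty (stateSpace E)] : Subsingleton E :=
  subsingleton_of_forall_eq 0 fun _ => eq_zero_of_forall_state fun σ => isEmptyElim σ

/-- The state space is `w*`-compact: it is a closed subset of `∏ₓ [-‖x‖, ‖x‖]`. -/
theorem compactSpace_weakStar : @CompactSpace (stateSpace E) (weakStarTopology E) := by
  let _ := weakStarTopology E
  let ι : stateSpace E → E → ℝ := fun σ x => σ.1 x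
  have hι : Topology.IsInducing ι := ⟨rfl⟩
  have hrange : Set.range ι = {φ : E → ℝ | (∀ x y, φ (x + y) = φ x + φ y) ∧
      (∀ (r : ℝ) (x : E), φ (r • x) = r * φ x) ∧ (∀ x, 0 ≤ x → 0 ≤ φ x) ∧ φ 1 = 1} := by
    ext φ
    constructor
    · rintro ⟨σ, rfl⟩
      exact ⟨fun x y => map_add _ _ _, fun r x => by simp [ι], σ.2.1, σ.2.2⟩
    · rintro ⟨h1, h2, h3, h4⟩
      exact ⟨⟨⟨⟨φ, h1⟩, h2⟩, h3, h4⟩, rfl⟩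
  have hclosed : IsClosed (Set.range ι) := by
    rw [hrange]
    simp only [Set.ofPred_and, Set.ofPred_forall]
    refine IsClosed.inter ?_ (IsClosed.inter ?_ (IsClosed.inter ?_ ?_))
    · exact isClosed_iInter fun x => isClosed_iInter fun y =>
        isClosed_eq (by fun_prop) (by fun_prop)
    · exact isClosed_iInter fun r => isClosed_iInter fun x =>
        isClosed_eq (by fun_prop) (by fun_prop)
    · exact isClosed_iInter fun x => isClosed_iInter fun _ =>
        isClosed_le (by fun_prop) (by fun_prop)
    · exact isClosed_eq (by fun_prop) (by fun_prop)
  have hcompact : IsCompact (Set.range ι) := by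
    refine (isCompact_univ_pi fun x : E => isCompact_Icc (a := -‖x‖) (b := ‖x‖)).of_isClosed_subset
      hclosed ?_
    rintro _ ⟨σ, rfl⟩ x -
    exact abs_le.1 (abs_state_le_norm σ x)
  exact ⟨hι.isCompact_iff.2 (by rwa [Set.image_univ])⟩

end OrderUnit

/-! ### Minimax approximation of affine functions -/

section Approximation

variable {E : Type u} [NormedAddCommGroup E] [NormedSpace ℝ E] [PartialOrder E] [One E]
  [OrderUnitSpace E]
variable {F : Type v} [NormedAddCommGroup F] [NormedSpace ℝ F] [PartialOrder F] [One F]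
  [OrderUnitSpace F]

/-- Uniform approximation of an affine function `f` on the state space of `E` by elements of a
convex set `Z` of elements of `F`, which become functions on `S(E)` through an affine map
`h : S(E) → S(F)`. If each single difference `f σ - f τ` is at most the supremum over `z ∈ Z` of
`(h σ)(z) - (h τ)(z)`, then one `z ∈ Z` works for all `σ` and `τ` up to `ε`. This is a minimax
principle: the error is affine in `(σ, τ)`, which ranges over a compact convex set, and
in `z`. -/
theorem exists_uniform_approx {h : stateSpace E → stateSpace F} (hh : IsAffineMap h)
    (hc : ∀ z, Continuous[weakStarTopology E, _] fun σ => (h σ).1 z)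
    {f : stateSpace E → ℝ} (hf : Continuous[weakStarTopology E, _] f)
    (hfa : ∀ (σ τ υ : stateSpace E) (a b : ℝ), 0 ≤ a → 0 ≤ b → a + b = 1 →
      υ.1 = a • σ.1 + b • τ.1 → f υ = a * f σ + b * f τ)
    {Z : Set F} (hZ : Convex ℝ Z) (hZ0 : Z.Nonempty)
    (hZ1 : ∀ z ∈ Z, ∀ c : ℝ, z + c • (1 : F) ∈ Z)
    (H : ∀ σ τ, ∀ δ : ℝ, 0 < δ → ∃ z ∈ Z, f σ - f τ < (h σ).1 z - (h τ).1 z + δ)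
    {ε : ℝ} (hε : 0 < ε) : ∃ z ∈ Z, ∀ σ, |f σ - (h σ).1 z| ≤ ε := by
  let _ := weakStarTopology E
  have : CompactSpace (stateSpace E) := compactSpace_weakStar
  rcases isEmpty_or_nonempty (stateSpace E) with hem | ⟨⟨σ₀⟩⟩
  · exact ⟨hZ0.some, hZ0.some_mem, fun σ => isEmptyElim σ⟩
  -- A pair of states becomes a function on `F`, so that Sion's theorem can be applied to a compact
  -- convex subset of the topological vector space `F → ℝ`.
  let w : stateSpace E × stateSpace E → F → ℝ := fun p z =>
    ((h p.1).1 z - (h p.2).1 z) - (f p.1 - f p.2)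
  have hw : Continuous w := by
    refine continuous_pi fun z => ?_
    exact (((hc z).comp continuous_fst).sub ((hc z).comp continuous_snd)).sub
      ((hf.comp continuous_fst).sub (hf.comp continuous_snd))
  have hcompact : IsCompact (Set.range w) := isCompact_range hw
  have hconv : Convex ℝ (Set.range w) := by
    rintro _ ⟨⟨σ, τ⟩, rfl⟩ _ ⟨⟨σ', τ'⟩, rfl⟩ a b ha hb hab
    obtain ⟨μ, hμ⟩ := exists_convexCombination σ σ' ha hb hab
    obtain ⟨ν, hν⟩ := exists_convexCombination τ τ' ha hb hab
    refine ⟨(μ, ν), funext fun z => ?_⟩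
    simp only [w, hh _ _ _ _ _ ha hb hab hμ, hh _ _ _ _ _ ha hb hab hν,
      hfa _ _ _ _ _ ha hb hab hμ, hfa _ _ _ _ _ ha hb hab hν, Pi.add_apply, Pi.smul_apply,
      LinearMap.add_apply, LinearMap.smul_apply, smul_eq_mul]
    ring
  have hcover : Set.range w ⊆ ⋃ z ∈ Z, {φ : F → ℝ | -ε < φ z} := by
    rintro _ ⟨⟨σ, τ⟩, rfl⟩
    obtain ⟨z, hz, hlt⟩ := H σ τ ε hε
    simp only [Set.mem_iUnion]
    exact ⟨z, hz, by simp only [w, Set.mem_ofPred_eq]; linarith⟩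
  obtain ⟨s, hsZ, hsf, hs⟩ := hcompact.elim_finite_subcover_image
    (fun z _ => isOpen_lt continuous_const (continuous_apply z)) hcover
  obtain ⟨z, hz, hzlt⟩ := Sion.exists_lt_iInf_of_lt_iInf_of_finite
    (X := Set.range w) (Y := Z) (f := fun φ z => φ z) (t := -ε)
    (ne_X := ⟨_, (σ₀, σ₀), rfl⟩) (kX := hcompact) (cX := hconv) (cY := hZ)
    (hfy := fun z _ => (continuous_apply z).lowerSemicontinuous.lowerSemicontinuousOn _)
    (hfy' := fun z _ => by
      refine ConvexOn.quasiconvexOn ⟨hconv, fun φ _ ψ _ a b _ _ _ => ?_⟩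
      simp)
    (hfx := by
      rintro _ ⟨⟨σ, τ⟩, rfl⟩
      exact (((continuous_state _).sub (continuous_state _)).sub
        continuous_const).upperSemicontinuous.upperSemicontinuousOn _)
    (hfx' := by
      rintro _ ⟨⟨σ, τ⟩, rfl⟩
      refine ConcaveOn.quasiconcaveOn ⟨hZ, fun y _ z _ a b _ _ hab => ?_⟩
      obtain rfl : b = 1 - a := by linarith
      simp only [w, map_add, map_smul, smul_eq_mul]
      exact le_of_eq (by ring))
    hsf hsZ (fun φ hφ => by simpa using hs hφ)
  -- `z` approximates the differences of values of `f`; a multiple of the unit corrects the values.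
  refine ⟨z + (f σ₀ - (h σ₀).1 z) • (1 : F), hZ1 z hz _, fun σ => ?_⟩
  have h1 := hzlt _ ⟨(σ, σ₀), rfl⟩
  have h2 := hzlt _ ⟨(σ₀, σ), rfl⟩
  simp only [w] at h1 h2
  rw [map_add, state_smul_unit, abs_le]
  constructor <;> linarith

end Approximation

/-! ### The distance of a Lip-norm -/

/-- Sublevel sets of a seminorm are rescalings of its unit ball. -/
theorem map_inv_smul_le_one {V : Type*} [AddCommGroup V] [Module ℝ V] {L : V → ℝ≥0∞}
    (hs : ∀ (r : ℝ) (x : V), L (r • x) = ENNReal.ofReal |r| * L x) 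
    {x : V} {c : ℝ} (hc : 0 < c)
    (hx : L x ≤ ENNReal.ofReal c) : L (c⁻¹ • x) ≤ 1 := by
  rw [hs, abs_of_pos (inv_pos.2 hc)]
  calc ENNReal.ofReal c⁻¹ * L x ≤ ENNReal.ofReal c⁻¹ * ENNReal.ofReal c := by gcongr
    _ = 1 := by rw [← ENNReal.ofReal_mul (inv_pos.2 hc).le, inv_mul_cancel₀ hc.ne',
      ENNReal.ofReal_one]

section LipNorm

variable {E : Type u} [NormedAddCommGroup E] [NormedSpace ℝ E] [PartialOrder E] [One E]
variable {L : E → ℝ≥0∞}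

theorem stateEMetric_congr {L' : E → ℝ≥0∞} (h : stateDist L' = stateDist L) :
    stateEMetric L' = stateEMetric L :=
  PseudoEMetricSpace.ext (congrArg EDist.mk h)

theorem stateHausdorffDist_congr {L' : E → ℝ≥0∞} (h : stateDist L' = stateDist L)
    (A B : Set (stateSpace E)) : stateHausdorffDist L' A B = stateHausdorffDist L A B :=
  congrArg (fun m => @Metric.hausdorffEDist _ m A B) (stateEMetric_congr h)

theorem ofReal_le_stateDist {x : E} (hx : L x ≤ 1) (σ τ : stateSpace E) :
    ENNReal.ofReal |σ.1 x - τ.1 x| ≤ stateDist L σ τ :=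
  le_iSup₂ (f := fun x (_ : L x ≤ 1) => ENNReal.ofReal |σ.1 x - τ.1 x|) x hx

theorem stateDist_comm (L : E → ℝ≥0∞) (σ τ : stateSpace E) :
    stateDist L σ τ = stateDist L τ σ := by
  simp only [stateDist, abs_sub_comm]

theorem ofReal_le_mul_stateDist (hs : ∀ (r : ℝ) (x : E), L (r • x) = ENNReal.ofReal |r| * L x) 
    {x : E} {c : ℝ} (hc : 0 < c)
    (hx : L x ≤ ENNReal.ofReal c) (σ τ : stateSpace E) :
    ENNReal.ofReal |σ.1 x - τ.1 x| ≤ ENNReal.ofReal c * stateDist L σ τ := by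
  have h := ofReal_le_stateDist (map_inv_smul_le_one hs hc hx) σ τ
  calc ENNReal.ofReal |σ.1 x - τ.1 x|
      = ENNReal.ofReal c * ENNReal.ofReal |σ.1 (c⁻¹ • x) - τ.1 (c⁻¹ • x)| := by
        rw [← ENNReal.ofReal_mul hc.le]
        congr 1
        rw [map_smul, map_smul, smul_eq_mul, smul_eq_mul, ← mul_sub, abs_mul,
          abs_of_pos (inv_pos.2 hc), mul_inv_cancel_left₀ hc.ne']
    _ ≤ _ := by gcongr

namespace IsLipNorm

theorem map_zero (hL : IsLipNorm L) : L 0 = 0 := (hL.eq_zero_iff 0).2 ⟨0, by simp⟩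

theorem add_smul_unit_le (hL : IsLipNorm L) (x : E) (c : ℝ) : L (x + c • (1 : E)) ≤ L x := by
  simpa [(hL.eq_zero_iff _).2 ⟨c, rfl⟩] using hL.add_le x (c • (1 : E))

theorem convex_lt_top (hL : IsLipNorm L) : Convex ℝ {x | L x < ⊤} := by
  intro x hx y hy a b _ _ _
  refine (hL.add_le _ _).trans_lt ?_
  rw [hL.smul_eq, hL.smul_eq]
  exact ENNReal.add_lt_top.2 ⟨ENNReal.mul_lt_top ENNReal.ofReal_lt_top hx,
    ENNReal.mul_lt_top ENNReal.ofReal_lt_top hy⟩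

theorem eq_of_stateDist_eq_zero (hL : IsLipNorm L) {σ τ : stateSpace E}
    (h : stateDist L σ τ = 0) : σ = τ := by
  let _ := stateEMetric L
  have : T2Space (stateSpace E) := by
    rw [hL.topology_eq]
    exact t2Space_weakStar
  exact (EMetric.inseparable_iff.2 h).eq

/-- The distance of a Lip-norm is finite: convex combinations of `σ` and `τ` close to `σ` are at
distance less than `1` from `σ`, and the distance is linear along the segment. -/
theorem stateDist_ne_top (hL : IsLipNorm L) (σ τ : stateSpace E) : stateDist L σ τ ≠ ⊤ := by
  have hex : ∀ n : ℕ, ∃ υ : stateSpace E,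
      υ.1 = (1 - 1 / ((n : ℝ) + 1)) • σ.1 + (1 / ((n : ℝ) + 1)) • τ.1 := fun n =>
    exists_convexCombination σ τ
      (sub_nonneg.2 (by rw [div_le_one (by positivity)]; linarith [n.cast_nonneg (α := ℝ)]))
      (by positivity) (by ring)
  choose υ hυ using hex
  have hlim : Filter.Tendsto υ Filter.atTop (@nhds _ (weakStarTopology E) σ) := by
    rw [nhds_induced, Filter.tendsto_comap_iff, tendsto_pi_nhds]
    intro x
    have h1 := tendsto_one_div_add_atTop_nhds_zero_nat (𝕜 := ℝ)
    have h2 := ((tendsto_const_nhds (x := (1 : ℝ))).sub h1).mul_const (σ.1 x)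
    have h3 := h2.add (h1.mul_const (τ.1 x))
    simpa [Function.comp_def, hυ] using h3
  rw [← hL.topology_eq] at hlim
  let _ := stateEMetric L
  obtain ⟨n, hn⟩ := ((EMetric.tendsto_nhds.1 hlim) 1 one_pos).exists
  have hn' : stateDist L (υ n) σ < 1 := hn
  refine ne_top_of_le_ne_top (ENNReal.ofReal_ne_top (r := (n : ℝ) + 1)) (iSup₂_le fun x hx => ?_)
  have h1 := (ofReal_le_stateDist hx (υ n) σ).trans hn'.le
  rw [← ENNReal.ofReal_one] at h1
  have h2 := (ENNReal.ofReal_le_ofReal_iff zero_le_one).1 h1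
  have h3 : (υ n).1 x - σ.1 x = (1 / ((n : ℝ) + 1)) * (τ.1 x - σ.1 x) := by
    simp only [hυ, LinearMap.add_apply, LinearMap.smul_apply, smul_eq_mul]
    ring
  rw [h3, abs_mul, abs_of_pos (by positivity), one_div, inv_mul_le_iff₀ (by positivity),
    mul_one, abs_sub_comm] at h2
  exact ENNReal.ofReal_le_ofReal h2

variable [OrderUnitSpace E]

/-- The elements of finite Lip-norm are dense. They separate the states, since `ρ_L` does, and the
minimax approximation applies. -/
theorem dense_lt_top (hL : IsLipNorm L) : Dense {x | L x < ⊤} := by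
  intro x
  refine Metric.mem_closure_iff.2 fun ε hε => ?_
  obtain ⟨z, hz, hxz⟩ := exists_uniform_approx (E := E) (F := E) (h := id)
    (f := fun σ => σ.1 x) (fun _ _ _ _ _ _ _ _ h => h) continuous_weakStar_eval
    (continuous_weakStar_eval x) (fun σ τ υ a b _ _ _ h => by simp [h])
    hL.convex_lt_top ⟨0, by simp [hL.map_zero]⟩
    (fun z hz c => (hL.add_smul_unit_le z c).trans_lt hz)
    (fun σ τ δ hδ => by
      by_cases h : stateDist L σ τ = 0
      · obtain rfl := hL.eq_of_stateDist_eq_zero h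
        exact ⟨0, by simp [hL.map_zero], by simpa using hδ⟩
      · obtain ⟨y, hy⟩ := lt_iSup_iff.1 (pos_iff_ne_zero.2 h)
        obtain ⟨hLy, hy⟩ := lt_iSup_iff.1 hy
        have hy0 : σ.1 y - τ.1 y ≠ 0 := by
          intro h0
          simp [h0] at hy
        refine ⟨((σ.1 x - τ.1 x) / (σ.1 y - τ.1 y)) • y, ?_, ?_⟩
        · rw [Set.mem_ofPred_eq, hL.smul_eq]
          exact ENNReal.mul_lt_top ENNReal.ofReal_lt_top (hLy.trans_lt ENNReal.one_lt_top)
        · simp only [id, map_smul, smul_eq_mul, ← mul_sub]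
          rw [div_mul_cancel₀ _ hy0]
          linarith)
    (half_pos hε)
  refine ⟨z, hz, ?_⟩
  rw [dist_eq_norm]
  refine (norm_le_of_forall_state (half_pos hε) fun σ => ?_).trans_lt (half_lt_self hε)
  simpa using hxz σ

end IsLipNorm

/-- The Lipschitz constant of `x`, regarded as a function on the states with the distance `ρ_L`.
A pair at distance `0` contributes `0 / 0 = 0` if `ρ_L` separates the states. -/
noncomputable def lipschitzSeminorm (L : E → ℝ≥0∞) (x : E) : ℝ≥0∞ :=
  ⨆ (σ : stateSpace E) (τ : stateSpace E), ENNReal.ofReal |σ.1 x - τ.1 x| / stateDist L σ τ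

theorem lipschitzSeminorm_le_one_iff {x : E} : lipschitzSeminorm L x ≤ 1 ↔
    ∀ σ τ : stateSpace E, ENNReal.ofReal |σ.1 x - τ.1 x| ≤ stateDist L σ τ := by
  simp only [lipschitzSeminorm, iSup_le_iff]
  refine forall₂_congr fun σ τ => ?_
  rw [ENNReal.div_le_iff_le_mul (.inr ENNReal.one_ne_top) (.inr one_ne_zero), one_mul]

theorem stateDist_lipschitzSeminorm (L : E → ℝ≥0∞) :
    stateDist (lipschitzSeminorm L) = stateDist L := by
  ext σ τ
  refine le_antisymm (iSup₂_le fun x hx => lipschitzSeminorm_le_one_iff.1 hx σ τ)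
    (iSup₂_le fun x hx => ofReal_le_stateDist ?_ σ τ)
  exact lipschitzSeminorm_le_one_iff.2 fun σ τ => ofReal_le_stateDist hx σ τ

variable [OrderUnitSpace E]

theorem IsLipNorm.lipschitzSeminorm (hL : IsLipNorm L) : IsLipNorm (lipschitzSeminorm L) where
  add_le x y := by
    refine iSup₂_le fun σ τ => ?_
    calc ENNReal.ofReal |σ.1 (x + y) - τ.1 (x + y)| / stateDist L σ τ
        ≤ (ENNReal.ofReal |σ.1 x - τ.1 x| + ENNReal.ofReal |σ.1 y - τ.1 y|) / stateDist L σ τ := by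
          rw [← ENNReal.ofReal_add (abs_nonneg _) (abs_nonneg _), map_add, map_add,
            add_sub_add_comm]
          gcongr
          exact abs_add_le _ _
      _ ≤ _ := by
          rw [ENNReal.add_div]
          exact add_le_add
            (le_iSup₂ (f := fun σ τ : stateSpace E =>
              ENNReal.ofReal |σ.1 x - τ.1 x| / stateDist L σ τ) σ τ)
            (le_iSup₂ (f := fun σ τ : stateSpace E =>
              ENNReal.ofReal |σ.1 y - τ.1 y| / stateDist L σ τ) σ τ)
  smul_eq r x := by
    simp only [QuantumMetric.lipschitzSeminorm, ENNReal.mul_iSup]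
    refine iSup_congr fun σ => iSup_congr fun τ => ?_
    rw [map_smul, map_smul, smul_eq_mul, smul_eq_mul, ← mul_sub, abs_mul,
      ENNReal.ofReal_mul (abs_nonneg r), mul_div_assoc]
  eq_zero_iff x := by
    constructor
    · intro h
      have hconst : ∀ σ τ : stateSpace E, σ.1 x = τ.1 x := by
        intro σ τ
        have h1 : ENNReal.ofReal |σ.1 x - τ.1 x| / stateDist L σ τ ≤ 0 :=
          h ▸ le_iSup₂ (f := fun σ τ : stateSpace E =>
            ENNReal.ofReal |σ.1 x - τ.1 x| / stateDist L σ τ) σ τ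
        rcases ENNReal.div_eq_zero_iff.1 (nonpos_iff_eq_zero.1 h1) with h2 | h2
        · rw [ENNReal.ofReal_eq_zero] at h2
          exact sub_eq_zero.1 (abs_nonpos_iff.1 h2)
        · exact absurd h2 (hL.stateDist_ne_top σ τ)
      rcases isEmpty_or_nonempty (stateSpace E) with hem | ⟨⟨σ₀⟩⟩
      · have := subsingleton_of_isEmpty_stateSpace (E := E)
        exact ⟨0, Subsingleton.elim _ _⟩
      · refine ⟨σ₀.1 x, sub_eq_zero.1 (eq_zero_of_forall_state fun σ => ?_)⟩
        rw [map_sub, state_smul_unit, hconst σ σ₀, sub_self]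
    · rintro ⟨r, rfl⟩
      simp [QuantumMetric.lipschitzSeminorm]
  topology_eq := by
    rw [stateEMetric_congr (stateDist_lipschitzSeminorm L), hL.topology_eq]

theorem IsLipNorm.lowerSemicontinuous_lipschitzSeminorm (hL : IsLipNorm L) :
    LowerSemicontinuous (QuantumMetric.lipschitzSeminorm L) := by
  refine lowerSemicontinuous_iSup fun σ => lowerSemicontinuous_iSup fun τ => ?_
  by_cases h : stateDist L σ τ = 0
  · obtain rfl := hL.eq_of_stateDist_eq_zero h
    simpa using lowerSemicontinuous_const
  · refine Continuous.lowerSemicontinuous ?_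
    refine ENNReal.continuous_div_const _ h |>.comp ?_
    exact ENNReal.continuous_ofReal.comp ((continuous_state σ).sub (continuous_state τ)).abs

end LipNorm

/-! ### Quotient seminorms and the ambient space of an admissible Lip-norm -/

/-- If `L_E` is the quotient of `L` under `π`, the dual map `σ ↦ σ ∘ π` of state spaces is
isometric. The infimum in the quotient seminorm need not be attained, so elements
of the unit ball are only lifted to balls of radius `c > 1`. -/
theorem stateDist_eq_of_quotient {E : Type u} [NormedAddCommGroup E] [NormedSpace ℝ E]
    [PartialOrder E] [One E] {L_E : E → ℝ≥0∞} {G : Type v} [NormedAddCommGroup G] [NormedSpace ℝ G]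
    [PartialOrder G] [One G] {L : G → ℝ≥0∞} (hL : IsLipNorm L) (π : G → E)
    (hπ : ∀ x, L_E x = sInf {c | ∃ z, π z = x ∧ L z = c})
    {h : stateSpace E → stateSpace G} (hh : ∀ σ z, (h σ).1 z = σ.1 (π z)) (σ τ : stateSpace E) :
    stateDist L (h σ) (h τ) = stateDist L_E σ τ := by
  refine le_antisymm (iSup₂_le fun z hz => ?_) (iSup₂_le fun x hx => ?_)
  · rw [hh, hh]
    refine ofReal_le_stateDist ?_ σ τ
    rw [hπ]
    have hmem : L z ∈ {c | ∃ z', π z' = π z ∧ L z' = c} := ⟨z, rfl, rfl⟩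
    exact (sInf_le hmem).trans hz
  · rcases eq_or_ne (stateDist L (h σ) (h τ)) ⊤ with htop | htop
    · exact htop ▸ le_top
    rw [← ENNReal.ofReal_toReal htop]
    refine ENNReal.ofReal_le_ofReal ((le_iff_forall_one_lt_le_mul₀ ENNReal.toReal_nonneg).2
      fun c hc => ?_)
    have hlt : L_E x < ENNReal.ofReal c := hx.trans_lt (ENNReal.one_lt_ofReal.2 hc)
    rw [hπ] at hlt
    obtain ⟨_, ⟨z, rfl, rfl⟩, hz⟩ := sInf_lt_iff.1 hlt
    have hc0 : 0 < c := zero_lt_one.trans hc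
    have h1 := ofReal_le_mul_stateDist hL.smul_eq hc0 hz.le (h σ) (h τ)
    rw [hh, hh] at h1
    have h2 := (ENNReal.ofReal_le_iff_le_toReal (ENNReal.mul_ne_top ENNReal.ofReal_ne_top htop)).1 h1
    rwa [ENNReal.toReal_mul, ENNReal.toReal_ofReal hc0.le, mul_comm] at h2

/-- The Riesz interpolation property passes to products with the componentwise order. -/
theorem riesz_prod {E : Type u} {F : Type v} [PartialOrder E] [PartialOrder F]
    (hE : ∀ x₁ x₂ y₁ y₂ : E, x₁ ≤ y₁ → x₁ ≤ y₂ → x₂ ≤ y₁ → x₂ ≤ y₂ →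
      ∃ z, x₁ ≤ z ∧ x₂ ≤ z ∧ z ≤ y₁ ∧ z ≤ y₂)
    (hF : ∀ x₁ x₂ y₁ y₂ : F, x₁ ≤ y₁ → x₁ ≤ y₂ → x₂ ≤ y₁ → x₂ ≤ y₂ →
      ∃ z, x₁ ≤ z ∧ x₂ ≤ z ∧ z ≤ y₁ ∧ z ≤ y₂)
    (x₁ x₂ y₁ y₂ : E × F) (h₁₁ : x₁ ≤ y₁) (h₁₂ : x₁ ≤ y₂) (h₂₁ : x₂ ≤ y₁) (h₂₂ : x₂ ≤ y₂) :
    ∃ z, x₁ ≤ z ∧ x₂ ≤ z ∧ z ≤ y₁ ∧ z ≤ y₂ := by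
  obtain ⟨a, a1, a2, a3, a4⟩ := hE _ _ _ _ h₁₁.1 h₁₂.1 h₂₁.1 h₂₂.1
  obtain ⟨b, b1, b2, b3, b4⟩ := hF _ _ _ _ h₁₁.2 h₁₂.2 h₂₁.2 h₂₂.2
  exact ⟨(a, b), ⟨a1, b1⟩, ⟨a2, b2⟩, ⟨a3, b3⟩, ⟨a4, b4⟩⟩

section Admissible

variable {E : Type u} [NormedAddCommGroup E] [NormedSpace ℝ E] [PartialOrder E] [One E]
variable {F : Type v} [NormedAddCommGroup F] [NormedSpace ℝ F] [PartialOrder F] [One F]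
variable {L_E : E → ℝ≥0∞} {L_F : F → ℝ≥0∞} {L : E × F → ℝ≥0∞}

theorem IsAdmissible.isAffineIsometricEmbedding_stateFst (hL : IsAdmissible L_E L_F L) :
    IsAffineIsometricEmbedding L_E (lipschitzSeminorm L) (stateFst (E := E) (F := F)) where
  affine σ τ υ a b _ _ _ h := by
    refine LinearMap.ext fun z => ?_
    simp [stateFst, h]
  isometric σ τ := by
    rw [stateDist_lipschitzSeminorm]
    exact stateDist_eq_of_quotient hL.isLipNorm Prod.fst hL.fst_eq (fun _ _ => rfl) σ τ

theorem IsAdmissible.isAffineIsometricEmbedding_stateSnd (hL : IsAdmissible L_E L_F L) :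
    IsAffineIsometricEmbedding L_F (lipschitzSeminorm L) (stateSnd (E := E) (F := F)) where
  affine σ τ υ a b _ _ _ h := by
    refine LinearMap.ext fun z => ?_
    simp [stateSnd, h]
  isometric σ τ := by
    rw [stateDist_lipschitzSeminorm]
    exact stateDist_eq_of_quotient hL.isLipNorm Prod.snd hL.snd_eq (fun _ _ => rfl) σ τ

/-- An isometric embedding is `w*`-continuous, since both distances induce the `w*`-topology. -/
theorem IsAffineIsometricEmbedding.continuous_eval {h : stateSpace E → stateSpace F}
    (hE : IsLipNorm L_E) (hF : IsLipNorm L_F) (hh : IsAffineIsometricEmbedding L_E L_F h)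
    (z : F) : Continuous[weakStarTopology E, _] fun σ => (h σ).1 z := by
  have h1 : Continuous[(stateEMetric L_E).toUniformSpace.toTopologicalSpace,
      (stateEMetric L_F).toUniformSpace.toTopologicalSpace] h := by
    let _ := stateEMetric L_E
    let _ := stateEMetric L_F
    exact Isometry.continuous (fun σ τ => hh.isometric σ τ)
  rw [hE.topology_eq, hF.topology_eq] at h1
  let _ := weakStarTopology E
  let _ := weakStarTopology F
  exact (continuous_weakStar_eval z).comp h1

variable [OrderUnitSpace E] [OrderUnitSpace F]

/-- Passing to the Lipschitz seminorm makes an admissible Lip-norm lower semicontinuous without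
changing its distance. -/
theorem IsAdmissible.isQMCS_lipschitzSeminorm (hE : IsQMCS L_E) (hF : IsQMCS L_F)
    (hL : IsAdmissible L_E L_F L) : IsQMCS (lipschitzSeminorm L) where
  isLipNorm := hL.isLipNorm.lipschitzSeminorm
  complete := by
    have := hE.complete
    have := hF.complete
    infer_instance
  riesz := riesz_prod hE.riesz hF.riesz
  lowerSemicontinuous := hL.isLipNorm.lowerSemicontinuous_lipschitzSeminorm
  denselyFinite := hL.isLipNorm.lipschitzSeminorm.dense_lt_top

end Admissible

/-! ### A compactness criterion for the topology of a Lip-norm -/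

section Topology

/-- A compact topology has no strictly coarser Hausdorff topology. -/
theorem eq_of_le_of_compactSpace_of_t2Space {X : Type*} {t₁ t₂ : TopologicalSpace X}
    (h : t₁ ≤ t₂) (hc : @CompactSpace X t₁) (ht : @T2Space X t₂) : t₁ = t₂ := by
  refine le_antisymm h fun s hs => ?_
  have h₁ : @IsCompact X t₁ sᶜ :=
    @IsClosed.isCompact X t₁ _ hc (@IsOpen.isClosed_compl X t₁ s hs)
  have h₂ : @IsCompact X t₂ (id '' sᶜ) :=
    @IsCompact.image X X t₁ t₂ sᶜ id h₁ (continuous_id_iff_le.2 h)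
  rw [Set.image_id] at h₂
  exact (@isClosed_compl_iff X t₂ s).1 (@IsCompact.isClosed X t₂ ht _ h₂)

variable {E : Type u} [NormedAddCommGroup E] [NormedSpace ℝ E] [PartialOrder E] [One E]
  [OrderUnitSpace E]

/-- A seminorm with dense domain induces a topology finer than the `w*`-topology, which is
Hausdorff; so the two topologies agree as soon as the former is compact. -/
theorem topology_eq_weakStar_of_compactSpace {L : E → ℝ≥0∞}
    (hs : ∀ (r : ℝ) (x : E), L (r • x) = ENNReal.ofReal |r| * L x)
    (hd : Dense {x | L x < ⊤})
    (hc : @CompactSpace (stateSpace E) (stateEMetric L).toUniformSpace.toTopologicalSpace) :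
    (stateEMetric L).toUniformSpace.toTopologicalSpace = weakStarTopology E := by
  have heval : ∀ x : E, Continuous[(stateEMetric L).toUniformSpace.toTopologicalSpace, _]
      fun σ : stateSpace E => σ.1 x := by
    intro x
    let _ := stateEMetric L
    refine continuous_of_uniform_approx_of_continuous fun u hu => ?_
    obtain ⟨ε, hε, hεu⟩ := Metric.mem_uniformity_dist.1 hu
    obtain ⟨y, hy, hxy⟩ := Metric.mem_closure_iff.1 (hd x) ε hε
    refine ⟨fun σ => σ.1 y, ?_, fun σ => hεu ?_⟩
    · have hc0 : 0 < (L y).toReal + 1 := by positivity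
      have hLy : L y ≤ ENNReal.ofReal ((L y).toReal + 1) :=
        (ENNReal.le_ofReal_iff_toReal_le hy.ne hc0.le).2 (by linarith)
      refine LipschitzWith.continuous (K := Real.toNNReal ((L y).toReal + 1)) fun σ τ => ?_
      rw [edist_dist, Real.dist_eq]
      exact ofReal_le_mul_stateDist hs hc0 hLy σ τ
    · rw [Real.dist_eq, ← map_sub]
      exact (abs_state_le_norm σ _).trans_lt (by rwa [← dist_eq_norm])
  have hcont : Continuous[(stateEMetric L).toUniformSpace.toTopologicalSpace,
      weakStarTopology E] id := by
    let _ := stateEMetric L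
    exact continuous_induced_rng.2 (continuous_pi heval)
  exact eq_of_le_of_compactSpace_of_t2Space (continuous_id_iff_le.1 hcont) hc t2Space_weakStar

end Topology

/-! ### Lifting unit balls through a common ambient space -/

section Lift

variable {E : Type u} [NormedAddCommGroup E] [NormedSpace ℝ E] [PartialOrder E] [One E]
  [OrderUnitSpace E]
variable {F : Type v} [NormedAddCommGroup F] [NormedSpace ℝ F] [PartialOrder F] [One F]
  [OrderUnitSpace F]
variable {G : Type w} [NormedAddCommGroup G] [NormedSpace ℝ G] [PartialOrder G] [One G]
  [OrderUnitSpace G]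
variable {L_E : E → ℝ≥0∞} {L_F : F → ℝ≥0∞} {L_G : G → ℝ≥0∞}

/-- An affine function on `S(E)` that is `1`-Lipschitz for the distance pulled back from `S(G)` is
a uniform limit of elements of the Lip-norm unit ball of `G`. -/
theorem exists_unitBall_approx (hG : IsLipNorm L_G) {h : stateSpace E → stateSpace G}
    (hh : IsAffineMap h)
    (hc : ∀ z, Continuous[weakStarTopology E, _] fun σ => (h σ).1 z)
    {f : stateSpace E → ℝ} (hf : Continuous[weakStarTopology E, _] f)
    (hfa : ∀ (σ τ υ : stateSpace E) (a b : ℝ), 0 ≤ a → 0 ≤ b → a + b = 1 →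
      υ.1 = a • σ.1 + b • τ.1 → f υ = a * f σ + b * f τ)
    (hfl : ∀ σ τ, ENNReal.ofReal |f σ - f τ| ≤ stateDist L_G (h σ) (h τ))
    {ε : ℝ} (hε : 0 < ε) : ∃ z, L_G z ≤ 1 ∧ ∀ σ, |f σ - (h σ).1 z| ≤ ε := by
  have hconv : Convex ℝ {z | L_G z ≤ 1} := by
    intro x hx y hy a b ha hb hab
    refine (hG.add_le _ _).trans ?_
    rw [hG.smul_eq, hG.smul_eq, abs_of_nonneg ha, abs_of_nonneg hb]
    calc ENNReal.ofReal a * L_G x + ENNReal.ofReal b * L_G y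
        ≤ ENNReal.ofReal a * 1 + ENNReal.ofReal b * 1 := by
          gcongr
          exacts [hx, hy]
      _ = 1 := by rw [mul_one, mul_one, ← ENNReal.ofReal_add ha hb, hab, ENNReal.ofReal_one]
  refine exists_uniform_approx hh hc hf hfa hconv ⟨0, by simp [hG.map_zero]⟩
    (fun z hz c => (hG.add_smul_unit_le z c).trans hz) (fun σ τ δ hδ => ?_) hε
  rcases le_or_gt (f σ - f τ) 0 with hle | hpos
  · exact ⟨0, by simp [hG.map_zero], by simpa using by linarith⟩
  · have hlt : ENNReal.ofReal (f σ - f τ - δ) < stateDist L_G (h σ) (h τ) := by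
      refine lt_of_lt_of_le ?_ (hfl σ τ)
      rw [abs_of_pos hpos]
      exact (ENNReal.ofReal_lt_ofReal_iff hpos).2 (by linarith)
    obtain ⟨z, hz⟩ := lt_iSup_iff.1 hlt
    obtain ⟨hLz, hz⟩ := lt_iSup_iff.1 hz
    have hz' := (ENNReal.ofReal_lt_ofReal_iff'.1 hz).1
    rcases abs_cases ((h σ).1 z - (h τ).1 z) with ⟨habs, -⟩ | ⟨habs, -⟩
    · exact ⟨z, hLz, by linarith⟩
    -- the supremum bounds an absolute value, so the sign of `z` may have to be changed
    · refine ⟨(-1 : ℝ) • z, ?_, ?_⟩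
      · rw [Set.mem_ofPred_eq, hG.smul_eq]
        simpa using hLz
      · simp only [map_smul, smul_eq_mul]
        linarith

/-- The lifting property behind admissibility: an element of the unit ball of `E` is transported
to `G`, and from there to `F`, with an arbitrarily small error. -/
theorem exists_unitBall_lift (hE : IsLipNorm L_E) (hF : IsLipNorm L_F) (hG : IsLipNorm L_G)
    {h₁ : stateSpace E → stateSpace G} {h₂ : stateSpace F → stateSpace G}
    (hh₁ : IsAffineIsometricEmbedding L_E L_G h₁) (hh₂ : IsAffineIsometricEmbedding L_F L_G h₂)
    {ε : ℝ} (hε : 0 < ε) {x : E} (hx : L_E x ≤ 1) :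
    ∃ y, L_F y ≤ 1 ∧ ∀ σ τ, ENNReal.ofReal |σ.1 x - τ.1 y| ≤
      stateDist L_G (h₁ σ) (h₂ τ) + ENNReal.ofReal ε := by
  obtain ⟨z, hz, hxz⟩ := exists_unitBall_approx hG hh₁.affine (hh₁.continuous_eval hE hG)
    (f := fun σ => σ.1 x) (continuous_weakStar_eval x) (fun σ τ υ a b _ _ _ h => by simp [h])
    (fun σ τ => hh₁.isometric σ τ ▸ ofReal_le_stateDist hx σ τ) (half_pos hε)
  obtain ⟨y, hy, hyz⟩ := exists_unitBall_approx hF (h := id) (fun _ _ _ _ _ _ _ _ h => h)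
    continuous_weakStar_eval (hh₂.continuous_eval hF hG z)
    (fun σ τ υ a b ha hb hab h => by simp [hh₂.affine σ τ υ a b ha hb hab h])
    (fun σ τ => hh₂.isometric σ τ ▸ ofReal_le_stateDist hz (h₂ σ) (h₂ τ)) (half_pos hε)
  refine ⟨y, hy, fun σ τ => ?_⟩
  have h1 : |σ.1 x - τ.1 y| ≤ |(h₁ σ).1 z - (h₂ τ).1 z| + ε := by
    have h2 := abs_le.1 (hxz σ)
    have h3 := abs_le.1 (hyz τ)
    have h4 := le_abs_self ((h₁ σ).1 z - (h₂ τ).1 z)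
    have h5 := neg_abs_le ((h₁ σ).1 z - (h₂ τ).1 z)
    simp only [id] at h3
    exact abs_le.2 ⟨by linarith, by linarith⟩
  refine (ENNReal.ofReal_le_ofReal h1).trans ?_
  rw [ENNReal.ofReal_add (abs_nonneg _) hε.le]
  gcongr
  exact ofReal_le_stateDist hz _ _

end Lift

/-! ### The bridge seminorm -/

section Bridge

variable {E : Type u} [NormedAddCommGroup E] [NormedSpace ℝ E] [PartialOrder E] [One E]
variable {F : Type v} [NormedAddCommGroup F] [NormedSpace ℝ F] [PartialOrder F] [One F]

/-- The seminorm on `E ⊕ F` whose unit ball consists of the pairs `(x, y)` in the product of the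
unit balls with `|σ(x) - τ(y)| ≤ d(σ, τ)` for all states `σ` of `E` and `τ` of `F`. -/
noncomputable def bridgeSeminorm (L_E : E → ℝ≥0∞) (L_F : F → ℝ≥0∞)
    (d : stateSpace E → stateSpace F → ℝ≥0∞) (z : E × F) : ℝ≥0∞ :=
  max (max (L_E z.1) (L_F z.2))
    (⨆ (σ : stateSpace E) (τ : stateSpace F), ENNReal.ofReal |σ.1 z.1 - τ.1 z.2| / d σ τ)

variable {L_E : E → ℝ≥0∞} {L_F : F → ℝ≥0∞} {d : stateSpace E → stateSpace F → ℝ≥0∞}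

theorem bridgeSeminorm_le_one_iff {z : E × F} : bridgeSeminorm L_E L_F d z ≤ 1 ↔
    (L_E z.1 ≤ 1 ∧ L_F z.2 ≤ 1) ∧ ∀ σ τ, ENNReal.ofReal |σ.1 z.1 - τ.1 z.2| ≤ d σ τ := by
  simp only [bridgeSeminorm, max_le_iff, iSup_le_iff]
  refine and_congr_right fun _ => forall₂_congr fun σ τ => ?_
  rw [ENNReal.div_le_iff_le_mul (.inr ENNReal.one_ne_top) (.inr one_ne_zero), one_mul]

theorem bridgeSeminorm_add_le (hE : IsLipNorm L_E) (hF : IsLipNorm L_F) (z z' : E × F) :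
    bridgeSeminorm L_E L_F d (z + z') ≤
      bridgeSeminorm L_E L_F d z + bridgeSeminorm L_E L_F d z' := by
  refine max_le (max_le ?_ ?_) (iSup₂_le fun σ τ => ?_)
  · exact (hE.add_le _ _).trans
      (add_le_add ((le_max_left _ _).trans (le_max_left _ _))
        ((le_max_left _ _).trans (le_max_left _ _)))
  · exact (hF.add_le _ _).trans
      (add_le_add ((le_max_right _ _).trans (le_max_left _ _))
        ((le_max_right _ _).trans (le_max_left _ _)))
  · have h : ∀ z : E × F,
        ENNReal.ofReal |σ.1 z.1 - τ.1 z.2| / d σ τ ≤ bridgeSeminorm L_E L_F d z := fun z =>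
      (le_iSup₂ (f := fun (σ : stateSpace E) (τ : stateSpace F) =>
        ENNReal.ofReal |σ.1 z.1 - τ.1 z.2| / d σ τ) σ τ).trans (le_max_right _ _)
    refine le_trans ?_ (add_le_add (h z) (h z'))
    rw [← ENNReal.add_div, ← ENNReal.ofReal_add (abs_nonneg _) (abs_nonneg _), Prod.fst_add,
      Prod.snd_add, map_add, map_add, add_sub_add_comm]
    gcongr
    exact abs_add_le _ _

theorem bridgeSeminorm_smul (hE : IsLipNorm L_E) (hF : IsLipNorm L_F) (r : ℝ) (z : E × F) :
    bridgeSeminorm L_E L_F d (r • z) = ENNReal.ofReal |r| * bridgeSeminorm L_E L_F d z := by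
  simp only [bridgeSeminorm, mul_max, ENNReal.mul_iSup, Prod.smul_fst, Prod.smul_snd,
    hE.smul_eq, hF.smul_eq]
  congr 1
  refine iSup_congr fun σ => iSup_congr fun τ => ?_
  rw [map_smul, map_smul, smul_eq_mul, smul_eq_mul, ← mul_sub, abs_mul,
    ENNReal.ofReal_mul (abs_nonneg r), mul_div_assoc]

theorem bridgeSeminorm_eq_zero_iff (hE : IsLipNorm L_E) (hF : IsLipNorm L_F)
    [Nonempty (stateSpace E)] [Nonempty (stateSpace F)] (hd : ∀ σ τ, d σ τ ≠ ⊤) (z : E × F) :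
    bridgeSeminorm L_E L_F d z = 0 ↔ ∃ r : ℝ, z = r • (1 : E × F) := by
  constructor
  · intro h
    have h' := h.le
    simp only [bridgeSeminorm, max_le_iff, iSup_le_iff] at h'
    simp only [nonpos_iff_eq_zero] at h'
    obtain ⟨⟨h1, h2⟩, h3⟩ := h'
    obtain ⟨r, hr⟩ := (hE.eq_zero_iff _).1 h1
    obtain ⟨s, hs⟩ := (hF.eq_zero_iff _).1 h2
    obtain ⟨σ⟩ := ‹Nonempty (stateSpace E)›
    obtain ⟨τ⟩ := ‹Nonempty (stateSpace F)›
    have hrs := (ENNReal.div_eq_zero_iff.1 (h3 σ τ)).resolve_right (hd σ τ)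
    rw [hr, hs, state_smul_unit, state_smul_unit, ENNReal.ofReal_eq_zero, abs_nonpos_iff,
      sub_eq_zero] at hrs
    exact ⟨r, Prod.ext hr (hrs ▸ hs)⟩
  · rintro ⟨r, rfl⟩
    have h1 := (hE.eq_zero_iff (r • (1 : E))).2 ⟨r, rfl⟩
    have h2 := (hF.eq_zero_iff (r • (1 : F))).2 ⟨r, rfl⟩
    simp [bridgeSeminorm, h1, h2]

variable [OrderUnitSpace E] [OrderUnitSpace F]

theorem dense_bridgeSeminorm_lt_top (hE : IsLipNorm L_E) (hF : IsLipNorm L_F) {ε : ℝ≥0∞}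
    (hε : ε ≠ 0) (hd : ∀ σ τ, ε ≤ d σ τ) : Dense {z | bridgeSeminorm L_E L_F d z < ⊤} := by
  refine (hE.dense_lt_top.prod hF.dense_lt_top).mono fun z hz => ?_
  refine max_lt (max_lt hz.1 hz.2) (lt_of_le_of_lt (iSup₂_le fun σ τ => ?_)
    (ENNReal.div_lt_top (ENNReal.ofReal_ne_top (r := ‖z.1‖ + ‖z.2‖)) hε))
  refine ENNReal.div_le_div (ENNReal.ofReal_le_ofReal ?_) (hd σ τ)
  exact (abs_sub _ _).trans (add_le_add (abs_state_le_norm σ _) (abs_state_le_norm τ _))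

/-- A positive functional is a multiple of a state. -/
theorem exists_state_of_nonneg [Nonempty (stateSpace E)] (φ : E →ₗ[ℝ] ℝ)
    (hφ : ∀ x, 0 ≤ x → 0 ≤ φ x) : ∃ σ : stateSpace E, φ = φ 1 • σ.1 := by
  rcases (hφ 1 OrderUnitSpace.unit_nonneg).eq_or_lt with h0 | h0
  · obtain ⟨σ⟩ := ‹Nonempty (stateSpace E)›
    refine ⟨σ, LinearMap.ext fun x => ?_⟩
    obtain ⟨r, -, h1, h2⟩ := exists_bound_unit x
    have h3 := hφ _ (sub_nonneg.2 h1)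
    have h4 := hφ _ (sub_nonneg.2 h2)
    rw [map_sub, map_neg, map_smul, ← h0, smul_zero] at h3
    rw [map_sub, map_smul, ← h0, smul_zero] at h4
    rw [← h0, zero_smul, LinearMap.zero_apply]
    linarith
  · refine ⟨⟨(φ 1)⁻¹ • φ, fun x hx => ?_, by simp [h0.ne']⟩, ?_⟩
    · simpa using mul_nonneg (inv_nonneg.2 h0.le) (hφ x hx)
    · simp [smul_smul, h0.ne']

/-- Every state of `E ⊕ F` is a convex combination of a state of `E` and a state of `F`. -/
theorem exists_convexCombination_stateFst_stateSnd [Nonempty (stateSpace E)]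
    [Nonempty (stateSpace F)] (s : stateSpace (E × F)) :
    ∃ (t : unitInterval) (σ : stateSpace E) (τ : stateSpace F),
      s.1 = (t : ℝ) • (stateFst (F := F) σ).1 + (1 - t : ℝ) • (stateSnd (E := E) τ).1 := by
  obtain ⟨σ, hσ⟩ := exists_state_of_nonneg (s.1 ∘ₗ LinearMap.inl ℝ E F)
    fun x hx => s.2.1 (x, 0) ⟨hx, le_rfl⟩
  obtain ⟨τ, hτ⟩ := exists_state_of_nonneg (s.1 ∘ₗ LinearMap.inr ℝ E F)
    fun y hy => s.2.1 (0, y) ⟨le_rfl, hy⟩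
  have h0 : 0 ≤ s.1 ((1 : E), (0 : F)) := s.2.1 _ ⟨OrderUnitSpace.unit_nonneg, le_rfl⟩
  have h1 : 0 ≤ s.1 ((0 : E), (1 : F)) := s.2.1 _ ⟨le_rfl, OrderUnitSpace.unit_nonneg⟩
  have h2 : s.1 ((1 : E), (0 : F)) + s.1 ((0 : E), (1 : F)) = 1 := by
    rw [← map_add, ← s.2.2]
    congr 1
    ext <;> simp
  refine ⟨⟨s.1 (1, 0), h0, by linarith⟩, σ, τ, LinearMap.ext fun z => ?_⟩
  have h3 : s.1 z = s.1 (z.1, 0) + s.1 (0, z.2) := by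
    rw [← map_add]
    congr 1
    ext <;> simp
  have h4 : s.1 (z.1, 0) = s.1 (1, 0) * σ.1 z.1 := by simpa using LinearMap.congr_fun hσ z.1
  have h5 : s.1 (0, z.2) = s.1 (0, 1) * τ.1 z.2 := by simpa using LinearMap.congr_fun hτ z.2
  have h6 : s.1 z = s.1 (1, 0) * σ.1 z.1 + (1 - s.1 (1, 0)) * τ.1 z.2 := by
    rw [h3, h4, h5, eq_sub_of_add_eq' h2]
  exact h6

/-- The distance of the bridge seminorm is compact: the state space is the image of the product of
`[0, 1]` and the two given state spaces under a map that is continuous for the distances. -/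
theorem compactSpace_bridgeSeminorm (hE : IsLipNorm L_E) (hF : IsLipNorm L_F)
    [Nonempty (stateSpace E)] [Nonempty (stateSpace F)] (hd : ∀ σ τ, d σ τ ≠ ⊤) :
    @CompactSpace (stateSpace (E × F))
      (stateEMetric (bridgeSeminorm L_E L_F d)).toUniformSpace.toTopologicalSpace := by
  let _ := stateEMetric L_E
  let _ := stateEMetric L_F
  let _ := stateEMetric (bridgeSeminorm L_E L_F d)
  have : CompactSpace (stateSpace E) := by
    rw [hE.topology_eq]
    exact compactSpace_weakStar
  have : CompactSpace (stateSpace F) := by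
    rw [hF.topology_eq]
    exact compactSpace_weakStar
  have hex : ∀ p : unitInterval × stateSpace E × stateSpace F, ∃ s : stateSpace (E × F),
      s.1 = (p.1 : ℝ) • (stateFst (F := F) p.2.1).1 +
        (1 - p.1 : ℝ) • (stateSnd (E := E) p.2.2).1 := fun p =>
    exists_convexCombination _ _ p.1.2.1 (sub_nonneg.2 p.1.2.2) (by ring)
  choose m hm using hex
  have hsurj : Function.Surjective m := by
    intro s
    obtain ⟨t, σ, τ, hs⟩ := exists_convexCombination_stateFst_stateSnd s
    exact ⟨(t, σ, τ), Subtype.ext ((hm _).trans hs.symm)⟩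
  have hbound : ∀ p q : unitInterval × stateSpace E × stateSpace F,
      edist (m p) (m q) ≤ edist p.2.1 q.2.1 + edist p.2.2 q.2.2 +
        ENNReal.ofReal |(p.1 : ℝ) - q.1| * d q.2.1 q.2.2 := by
    rintro ⟨t, σ, τ⟩ ⟨t₀, σ₀, τ₀⟩
    refine iSup₂_le fun z hz => ?_
    obtain ⟨⟨h1, h2⟩, h3⟩ := bridgeSeminorm_le_one_iff.1 hz
    have heq : (m (t, σ, τ)).1 z - (m (t₀, σ₀, τ₀)).1 z =
        t * (σ.1 z.1 - σ₀.1 z.1) + (1 - t) * (τ.1 z.2 - τ₀.1 z.2) +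
          (t - t₀) * (σ₀.1 z.1 - τ₀.1 z.2) := by
      simp only [hm, stateFst, stateSnd, LinearMap.add_apply, LinearMap.smul_apply, smul_eq_mul,
        LinearMap.comp_apply, LinearMap.fst_apply, LinearMap.snd_apply]
      ring
    have hle : |(m (t, σ, τ)).1 z - (m (t₀, σ₀, τ₀)).1 z| ≤
        |σ.1 z.1 - σ₀.1 z.1| + |τ.1 z.2 - τ₀.1 z.2| +
          |(t : ℝ) - t₀| * |σ₀.1 z.1 - τ₀.1 z.2| := by
      rw [heq, ← abs_mul]
      refine (abs_add_three _ _ _).trans (add_le_add_left (add_le_add ?_ ?_) _)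
      · rw [abs_mul, abs_of_nonneg t.2.1]
        exact mul_le_of_le_one_left (abs_nonneg _) t.2.2
      · rw [abs_mul, abs_of_nonneg (sub_nonneg.2 t.2.2)]
        exact mul_le_of_le_one_left (abs_nonneg _) (by linarith [t.2.1])
    refine (ENNReal.ofReal_le_ofReal hle).trans ?_
    rw [ENNReal.ofReal_add (by positivity) (by positivity),
      ENNReal.ofReal_add (by positivity) (by positivity), ENNReal.ofReal_mul (abs_nonneg _)]
    gcongr
    · exact ofReal_le_stateDist h1 σ σ₀
    · exact ofReal_le_stateDist h2 τ τ₀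
    · exact h3 σ₀ τ₀
  have hcont : Continuous m := by
    refine continuous_iff_continuousAt.2 fun q => tendsto_iff_edist_tendsto_0.2 ?_
    have h1 : Filter.Tendsto (fun p : unitInterval × stateSpace E × stateSpace F =>
        edist p.2.1 q.2.1 + edist p.2.2 q.2.2 +
          ENNReal.ofReal |(p.1 : ℝ) - q.1| * d q.2.1 q.2.2) (𝓝 q) (𝓝 0) := by
      have ha : Continuous fun p : unitInterval × stateSpace E × stateSpace F =>
          edist p.2.1 q.2.1 + edist p.2.2 q.2.2 := by fun_prop
      have hb : Continuous fun p : unitInterval × stateSpace E × stateSpace F =>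
          ENNReal.ofReal |(p.1 : ℝ) - q.1| * d q.2.1 q.2.2 :=
        (ENNReal.continuous_mul_const (hd _ _)).comp
          (ENNReal.continuous_ofReal.comp (by fun_prop))
      have hab : Continuous fun p : unitInterval × stateSpace E × stateSpace F =>
          edist p.2.1 q.2.1 + edist p.2.2 q.2.2 +
            ENNReal.ofReal |(p.1 : ℝ) - q.1| * d q.2.1 q.2.2 := ha.add hb
      simpa using hab.tendsto q
    exact tendsto_of_tendsto_of_tendsto_of_le_of_le tendsto_const_nhds h1
      (fun _ => zero_le) fun p => hbound p q
  exact ⟨by simpa [hsurj.range_eq] using isCompact_range hcont⟩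

theorem isLipNorm_bridgeSeminorm (hE : IsLipNorm L_E) (hF : IsLipNorm L_F)
    [Nonempty (stateSpace E)] [Nonempty (stateSpace F)] {ε : ℝ≥0∞} (hε : ε ≠ 0)
    (hd : ∀ σ τ, ε ≤ d σ τ) (hd' : ∀ σ τ, d σ τ ≠ ⊤) :
    IsLipNorm (bridgeSeminorm L_E L_F d) where
  add_le := bridgeSeminorm_add_le hE hF
  smul_eq := bridgeSeminorm_smul hE hF
  eq_zero_iff := bridgeSeminorm_eq_zero_iff hE hF hd'
  topology_eq := topology_eq_weakStar_of_compactSpace (bridgeSeminorm_smul hE hF)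
    (dense_bridgeSeminorm_lt_top hE hF hε hd) (compactSpace_bridgeSeminorm hE hF hd')

end Bridge

/-! ### Comparison of the two distances -/

section Comparison

variable {E : Type u} [NormedAddCommGroup E] [NormedSpace ℝ E] [PartialOrder E] [One E]
variable {F : Type v} [NormedAddCommGroup F] [NormedSpace ℝ F] [PartialOrder F] [One F]
variable {G : Type w} [NormedAddCommGroup G] [NormedSpace ℝ G] [PartialOrder G] [One G]
variable {L_E : E → ℝ≥0∞} {L_F : F → ℝ≥0∞} {L_G : G → ℝ≥0∞}

/-- To present `L_E` as the quotient of a seminorm `L`, it suffices that `L` dominates `L_E` and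
that elements of the unit ball of `L_E` lift to the unit ball of `L`. -/
theorem eq_sInf_of_unitBall_lift {V W : Type*} [AddCommGroup V] [Module ℝ V] [AddCommGroup W]
    [Module ℝ W] {p : V → ℝ≥0∞} {q : W → ℝ≥0∞} (π : W →ₗ[ℝ] V)
    (hp : ∀ (r : ℝ) (x : V), p (r • x) = ENNReal.ofReal |r| * p x)
    (hq : ∀ (r : ℝ) (z : W), q (r • z) = ENNReal.ofReal |r| * q z)
    (hle : ∀ z, p (π z) ≤ q z) (hlift : ∀ x, p x ≤ 1 → ∃ z, π z = x ∧ q z ≤ 1) (x : V) :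
    p x = sInf {c | ∃ z, π z = x ∧ q z = c} := by
  refine le_antisymm (le_sInf ?_) (le_of_forall_gt_imp_ge_of_dense fun b hb => ?_)
  · rintro _ ⟨z, rfl, rfl⟩
    exact hle z
  · rcases eq_or_ne b ⊤ with rfl | hbt
    · exact le_top
    have hb0 : 0 < b.toReal := ENNReal.toReal_pos (bot_le.trans_lt hb).ne' hbt
    obtain ⟨z, hz, hqz⟩ := hlift _ (map_inv_smul_le_one hp hb0
      (by rw [ENNReal.ofReal_toReal hbt]; exact hb.le))
    have hmem : q (b.toReal • z) ∈ {c | ∃ z, π z = x ∧ q z = c} :=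
      ⟨b.toReal • z, by rw [map_smul, hz, smul_inv_smul₀ hb0.ne'], rfl⟩
    refine (sInf_le hmem).trans ?_
    rw [hq, abs_of_pos hb0, ENNReal.ofReal_toReal hbt]
    exact mul_le_of_le_one_right' hqz

theorem IsAdmissible.quantumDist_le {L : E × F → ℝ≥0∞} (hL : IsAdmissible L_E L_F L) :
    quantumDist L_E L_F ≤ stateHausdorffDist L (Set.range stateFst) (Set.range stateSnd) :=
  sInf_le ⟨L, hL, rfl⟩

/-- Distances in the bridge exceed those in `S(G)` by at most `ε`, hence so does the Hausdorff
distance. -/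
theorem stateHausdorffDist_le_add {L : E × F → ℝ≥0∞} {h₁ : stateSpace E → stateSpace G}
    {h₂ : stateSpace F → stateSpace G} {ε : ℝ≥0∞}
    (h : ∀ σ τ, stateDist L (stateFst σ) (stateSnd τ) ≤ stateDist L_G (h₁ σ) (h₂ τ) + ε) :
    stateHausdorffDist L (Set.range stateFst) (Set.range stateSnd) ≤
      stateHausdorffDist L_G (Set.range h₁) (Set.range h₂) + ε := by
  let _ := stateEMetric L
  let _ := stateEMetric L_G
  refine Metric.hausdorffEDist_le_of_infEDist ?_ ?_
  · rintro _ ⟨σ, rfl⟩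
    refine le_trans ?_ (add_le_add_left
      (Metric.infEDist_le_hausdorffEDist_of_mem (Set.mem_range_self (f := h₁) σ)) ε)
    rw [Metric.infEDist, Metric.infEDist, iInf_range, iInf_range, ENNReal.iInf_add]
    exact iInf_mono fun τ => h σ τ
  · rintro _ ⟨τ, rfl⟩
    change _ ≤ Metric.hausdorffEDist (Set.range h₁) (Set.range h₂) + ε
    rw [Metric.hausdorffEDist_comm]
    refine le_trans ?_ (add_le_add_left
      (Metric.infEDist_le_hausdorffEDist_of_mem (Set.mem_range_self (f := h₂) τ)) ε)
    rw [Metric.infEDist, Metric.infEDist, iInf_range, iInf_range, ENNReal.iInf_add]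
    refine iInf_mono fun σ => ?_
    rw [edist_comm, edist_comm (h₂ τ)]
    exact h σ τ

theorem quantumDist_eq_zero_of_subsingleton [Subsingleton E] [Subsingleton F]
    (hE : IsLipNorm L_E) (hF : IsLipNorm L_F) : quantumDist L_E L_F = 0 := by
  have hem : IsEmpty (stateSpace E) := ⟨fun σ => by
    simpa [Subsingleton.elim (1 : E) 0] using state_one σ⟩
  have hem' : IsEmpty (stateSpace F) := ⟨fun σ => by
    simpa [Subsingleton.elim (1 : F) 0] using state_one σ⟩
  have hem'' : IsEmpty (stateSpace (E × F)) := ⟨fun σ => by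
    simpa [Subsingleton.elim (1 : E × F) 0] using state_one σ⟩
  have hsInf : ∀ (P : E × F → Prop), (∀ z, P z) →
      sInf {c : ℝ≥0∞ | ∃ z : E × F, P z ∧ (0 : ℝ≥0∞) = c} = 0 := fun P hP =>
    nonpos_iff_eq_zero.1 (sInf_le ⟨0, hP 0, rfl⟩)
  refine nonpos_iff_eq_zero.1 (sInf_le ⟨fun _ => 0,
    ⟨⟨by simp, by simp, fun x => ?_, ?_⟩, ?_, ?_⟩, ?_⟩)
  · exact ⟨fun _ => ⟨0, Subsingleton.elim _ _⟩, fun _ => rfl⟩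
  · exact Subsingleton.elim _ _
  · intro x
    rw [Subsingleton.elim x 0, hE.map_zero, hsInf _ fun z => Subsingleton.elim _ _]
  · intro y
    rw [Subsingleton.elim y 0, hF.map_zero, hsInf _ fun z => Subsingleton.elim _ _]
  · rw [Set.range_eq_empty, Set.range_eq_empty]
    exact (@Metric.hausdorffEDist_self _ (stateEMetric _) ∅).symm

variable [OrderUnitSpace E] [OrderUnitSpace F] [OrderUnitSpace G]

theorem isAdmissible_bridgeSeminorm (hE : IsLipNorm L_E) (hF : IsLipNorm L_F) (hG : IsLipNorm L_G)
    [Nonempty (stateSpace E)] [Nonempty (stateSpace F)]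
    {h₁ : stateSpace E → stateSpace G} {h₂ : stateSpace F → stateSpace G}
    (hh₁ : IsAffineIsometricEmbedding L_E L_G h₁) (hh₂ : IsAffineIsometricEmbedding L_F L_G h₂)
    {ε : ℝ} (hε : 0 < ε) : IsAdmissible L_E L_F (bridgeSeminorm L_E L_F
      fun σ τ => stateDist L_G (h₁ σ) (h₂ τ) + ENNReal.ofReal ε) where
  isLipNorm := isLipNorm_bridgeSeminorm hE hF (ENNReal.ofReal_pos.2 hε).ne'
    (fun _ _ => le_add_self)
    fun _ _ => ENNReal.add_ne_top.2 ⟨hG.stateDist_ne_top _ _, ENNReal.ofReal_ne_top⟩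
  fst_eq := eq_sInf_of_unitBall_lift (LinearMap.fst ℝ E F) hE.smul_eq (bridgeSeminorm_smul hE hF)
    (fun _ => (le_max_left _ _).trans (le_max_left _ _)) fun x hx => by
      obtain ⟨y, hy, hxy⟩ := exists_unitBall_lift hE hF hG hh₁ hh₂ hε hx
      exact ⟨(x, y), rfl, bridgeSeminorm_le_one_iff.2 ⟨⟨hx, hy⟩, hxy⟩⟩
  snd_eq := eq_sInf_of_unitBall_lift (LinearMap.snd ℝ E F) hF.smul_eq (bridgeSeminorm_smul hE hF)
    (fun _ => (le_max_right _ _).trans (le_max_left _ _)) fun y hy => by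
      obtain ⟨x, hx, hxy⟩ := exists_unitBall_lift hF hE hG hh₂ hh₁ hε hy
      refine ⟨(x, y), rfl, bridgeSeminorm_le_one_iff.2 ⟨⟨hx, hy⟩, fun σ τ => ?_⟩⟩
      rw [abs_sub_comm, stateDist_comm]
      exact hxy τ σ

/-- The bridge seminorms show that the quantum distance is at most the Hausdorff distance in any
common ambient state space. -/
theorem quantumDist_le_stateHausdorffDist (hE : IsLipNorm L_E) (hF : IsLipNorm L_F)
    (hG : IsLipNorm L_G) {h₁ : stateSpace E → stateSpace G} {h₂ : stateSpace F → stateSpace G}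
    (hh₁ : IsAffineIsometricEmbedding L_E L_G h₁)
    (hh₂ : IsAffineIsometricEmbedding L_F L_G h₂) :
    quantumDist L_E L_F ≤ stateHausdorffDist L_G (Set.range h₁) (Set.range h₂) := by
  rcases isEmpty_or_nonempty (stateSpace E) with hemE | hneE <;>
    rcases isEmpty_or_nonempty (stateSpace F) with hemF | hneF
  · have := subsingleton_of_isEmpty_stateSpace (E := E)
    have := subsingleton_of_isEmpty_stateSpace (E := F)
    exact (quantumDist_eq_zero_of_subsingleton hE hF).trans_le bot_le
  · -- the Hausdorff distance of the empty set to a nonempty set is infinite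
    have h : stateHausdorffDist L_G (Set.range h₁) (Set.range h₂) = ⊤ := by
      let _ := stateEMetric L_G
      rw [Set.range_eq_empty h₁, stateHausdorffDist, Metric.hausdorffEDist_comm]
      exact Metric.hausdorffEDist_empty (Set.range_nonempty h₂)
    exact h ▸ le_top
  · have h : stateHausdorffDist L_G (Set.range h₁) (Set.range h₂) = ⊤ := by
      let _ := stateEMetric L_G
      rw [Set.range_eq_empty h₂]
      exact Metric.hausdorffEDist_empty (Set.range_nonempty h₁)
    exact h ▸ le_top
  · refine ENNReal.le_of_forall_pos_le_add fun ε hε _ => ?_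
    refine (isAdmissible_bridgeSeminorm hE hF hG hh₁ hh₂
      (NNReal.coe_pos.2 hε)).quantumDist_le.trans ?_
    refine stateHausdorffDist_le_add fun σ τ => iSup₂_le fun z hz => ?_
    have h := (bridgeSeminorm_le_one_iff.1 hz).2 σ τ
    rwa [ENNReal.ofReal_coe_nnreal] at h

end Comparison

end QuantumMetric

theorem mainTheorem12
    {E₁ : Type u} [NormedAddCommGroup E₁] [NormedSpace ℝ E₁] [PartialOrder E₁] [One E₁]
    [QuantumMetric.OrderUnitSpace E₁]
    {E₂ : Type v} [NormedAddCommGroup E₂] [NormedSpace ℝ E₂] [PartialOrder E₂] [One E₂]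
    [QuantumMetric.OrderUnitSpace E₂]
    (L₁ : E₁ → ℝ≥0∞) (L₂ : E₂ → ℝ≥0∞)
    (hL₁ : QuantumMetric.IsQMCS L₁) (hL₂ : QuantumMetric.IsQMCS L₂) :
    QuantumMetric.quantumDist L₁ L₂ =
      sInf {d : ℝ≥0∞ | ∃ (E : Type (max u v)) (_ : NormedAddCommGroup E) (_ : NormedSpace ℝ E)
        (_ : PartialOrder E) (_ : One E) (_ : QuantumMetric.OrderUnitSpace E)
        (L : E → ℝ≥0∞) (_ : QuantumMetric.IsQMCS L)
        (h₁ : QuantumMetric.stateSpace E₁ → QuantumMetric.stateSpace E)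
        (h₂ : QuantumMetric.stateSpace E₂ → QuantumMetric.stateSpace E),
        QuantumMetric.IsAffineIsometricEmbedding L₁ L h₁ ∧
        QuantumMetric.IsAffineIsometricEmbedding L₂ L h₂ ∧
        d = QuantumMetric.stateHausdorffDist L (Set.range h₁) (Set.range h₂)} := by
  refine le_antisymm (le_sInf ?_) (le_sInf ?_)
  · rintro _ ⟨E, _, _, _, _, _, L, hL, h₁, h₂, hh₁, hh₂, rfl⟩
    exact QuantumMetric.quantumDist_le_stateHausdorffDist hL₁.isLipNorm hL₂.isLipNorm
      hL.isLipNorm hh₁ hh₂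
  · rintro _ ⟨L, hL, rfl⟩
    refine sInf_le ⟨E₁ × E₂, inferInstance, inferInstance, inferInstance, inferInstance,
      inferInstance, QuantumMetric.lipschitzSeminorm L, hL.isQMCS_lipschitzSeminorm hL₁ hL₂,
      QuantumMetric.stateFst, QuantumMetric.stateSnd, hL.isAffineIsometricEmbedding_stateFst,
      hL.isAffineIsometricEmbedding_stateSnd, ?_⟩
    exact (QuantumMetric.stateHausdorffDist_congr
      (QuantumMetric.stateDist_lipschitzSeminorm L) _ _).symm
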